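/- Theorem (Gumbel watermark as optimal transport). Let $\mathcal X$ be a finite set of tokens, let $P_X$ be a probability distribution on $\mathcal X$ (zero probabilities are allowed), and let $f(x,s)$, $x\in\mathcal X$, $s=1,2,3,\dots$, be i.i.d. $\mathrm{Gumbel}(0,1)$ random variables, i.e. $\Pr[f(x,s)\le t]=e^{-e^{-t}}$. For each $k\ge 1$ consider the optimal transport problem with the scores $(f(x,s))_{x\in\mathcal X,\,1\le s\le k}$, $$\max_{P_{XS}}\ \sum_{x\in\mathcal X}\sum_{s=1}^k P_{XS}(x,s)\,f(x,s)\quad\text{subject to}\quad \sum_{s}P_{XS}(x,s)=P_X(x)\ \ \forall x,\qquad \sum_{x}P_{XS}(x,s)=\tfrac1k\ \ \forall s,\qquad P_{XS}\ge 0 .$$ The Gumbel (Aaronson) watermark is the rule that, given side information $g=(g_x)_{x\in\mathcal X}$ with i.i.d. $\mathrm{Gumbel}(0,1)$ entries, selects the token $x^*(g)=\arg\max_{x}\,[\log P_X(x)+g_x]$, where $\log 0=-\infty$; with $g_x=-\log(-\log u_x)$ and $u_x$ i.i.d. uniform on $(0,1)$, this is the token with $P_X(x)>0$ that maximizes $u_x^{1/P_X(x)}$.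 Then: 1. For every $k\ge1$ and every score matrix, the optimal transport problem has a solution. 2. The maximizer $x^*(g)$ is almost surely unique, and $\Pr[x^*(g)=x]=P_X(x)$ for all $x\in\mathcal X$. 3. Almost surely, for every choice of solutions $P^{(k)}_{XS}$ of the problems, $k\ge 1$, $$\sum_{x\in\mathcal X}\sum_{s=1}^k\Bigl|P^{(k)}_{XS}(x,s)-\tfrac1k\,\mathbf 1\{x=x^*(f(\cdot,s))\}\Bigr|\ \longrightarrow\ 0\qquad (k\to\infty),$$ that is, the distance in $\ell^1$ between the optimal coupling and the coupling produced by the Gumbel watermark with the same scores tends to zero. 4. The joint law of the token and its side information converges to that of the Gumbel watermark: for every $\varphi:\mathcal X\times\mathbb R^{\mathcal X}\to\mathbb R$ such that $\mathbb E|\varphi(x,g)|<\infty$ for all $x$, almost surely, for every choice of solutions $P^{(k)}_{XS}$, $$\sum_{x\in\mathcal X}\sum_{s=1}^k P^{(k)}_{XS}(x,s)\,\varphi\bigl(x,f(\cdot,s)\bigr)\ \longrightarrow\ \mathbb E\bigl[\varphi(x^*(g),g)\bigr]\qquad(k\to\infty).$$ In particular ($\varphi(x,g)=g_x$) the optimal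 values converge almost surely to $\mathbb E[g_{x^*(g)}]$. -/

import Mathlib

open MeasureTheory ProbabilityTheory Filter Topology
open scoped ENNReal

/-- The density `e^{-(t + e^{-t})}` of the standard Gumbel distribution. -/
noncomputable def gumbelPDFReal (t : ℝ) : ℝ :=
  Real.exp (-(t + Real.exp (-t)))

/-- The standard Gumbel distribution `Gumbel(0,1)` on the real line. -/
noncomputable def gumbelMeasure : Measure ℝ :=
  volume.withDensity (fun t => ENNReal.ofReal (gumbelPDFReal t))

theorem gumbelPDFReal_nonneg (t : ℝ) : 0 ≤ gumbelPDFReal t := (Real.exp_pos _).le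

theorem continuous_gumbelPDFReal : Continuous gumbelPDFReal := by
  unfold gumbelPDFReal
  fun_prop

theorem hasDerivAt_gumbelCDF (t : ℝ) :
    HasDerivAt (fun t : ℝ => Real.exp (-Real.exp (-t))) (gumbelPDFReal t) t := by
  have h1 : HasDerivAt (fun t : ℝ => -t) (-1) t := (hasDerivAt_id t).neg
  have h2 : HasDerivAt (fun t : ℝ => Real.exp (-Real.exp (-t)))
      (Real.exp (-Real.exp (-t)) * -(Real.exp (-t) * -1)) t := h1.exp.neg.exp
  have h3 : gumbelPDFReal t = Real.exp (-Real.exp (-t)) * -(Real.exp (-t) * -1) := by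
    unfold gumbelPDFReal
    rw [neg_add, Real.exp_add]
    ring
  rw [h3]
  exact h2

theorem tendsto_gumbelCDF_atBot :
    Tendsto (fun t : ℝ => Real.exp (-Real.exp (-t))) atBot (𝓝 0) :=
  Real.tendsto_exp_atBot.comp
    (tendsto_neg_atTop_atBot.comp (Real.tendsto_exp_atTop.comp tendsto_neg_atBot_atTop))

theorem tendsto_gumbelCDF_atTop :
    Tendsto (fun t : ℝ => Real.exp (-Real.exp (-t))) atTop (𝓝 1) := by
  have h1 : Tendsto (fun t : ℝ => Real.exp (-t)) atTop (𝓝 0) :=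
    Real.tendsto_exp_atBot.comp tendsto_neg_atTop_atBot
  have h2 : Tendsto (fun t : ℝ => -Real.exp (-t)) atTop (𝓝 0) := by simpa using h1.neg
  have h3 := (Real.continuous_exp.tendsto 0).comp h2
  rw [Real.exp_zero] at h3
  exact h3

/-- The distribution function of `Gumbel(0,1)` is `t ↦ e^{-e^{-t}}`. -/
theorem gumbelMeasure_Iic (t : ℝ) :
    gumbelMeasure (Set.Iic t) = ENNReal.ofReal (Real.exp (-Real.exp (-t))) := by
  have hint : ∀ a b : ℝ, ∫ x in a..b, gumbelPDFReal x
      = Real.exp (-Real.exp (-b)) - Real.exp (-Real.exp (-a)) := fun a b =>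
    intervalIntegral.integral_eq_sub_of_hasDerivAt (fun x _ => hasDerivAt_gumbelCDF x)
      (continuous_gumbelPDFReal.intervalIntegrable a b)
  have hI : IntegrableOn gumbelPDFReal (Set.Iic t) := by
    refine integrableOn_Iic_of_intervalIntegral_norm_tendsto (l := atBot) (a := id)
      (Real.exp (-Real.exp (-t))) t
      (fun i => continuous_gumbelPDFReal.integrableOn_Ioc) tendsto_id ?_
    simp only [Real.norm_of_nonneg (gumbelPDFReal_nonneg _), hint, id]
    simpa using tendsto_gumbelCDF_atBot.const_sub (Real.exp (-Real.exp (-t)))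
  have hv := integral_Iic_of_hasDerivAt_of_tendsto' (a := t)
    (fun x _ => hasDerivAt_gumbelCDF x) hI tendsto_gumbelCDF_atBot
  rw [gumbelMeasure, withDensity_apply _ measurableSet_Iic,
    ← ofReal_integral_eq_lintegral_ofReal hI (ae_of_all _ gumbelPDFReal_nonneg), hv, sub_zero]

instance : IsProbabilityMeasure gumbelMeasure := by
  constructor
  have h1 : Tendsto (fun t : ℝ => gumbelMeasure (Set.Iic t)) atTop
      (𝓝 (gumbelMeasure Set.univ)) := tendsto_measure_Iic_atTop gumbelMeasure
  have h2 : Tendsto (fun t : ℝ => gumbelMeasure (Set.Iic t)) atTop (𝓝 1) := by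
    simp only [gumbelMeasure_Iic]
    simpa using ENNReal.tendsto_ofReal tendsto_gumbelCDF_atTop
  exact tendsto_nhds_unique h1 h2

/-- `π` is a coupling of the token distribution `p` on `X` and the uniform distribution on
`k` side information values. -/
structure IsUniformCoupling {X : Type*} [Fintype X] (p : X → ℝ) (k : ℕ)
    (π : X → Fin k → ℝ) : Prop where
  nonneg : ∀ x s, 0 ≤ π x s
  sum_right : ∀ x, ∑ s, π x s = p x
  sum_left : ∀ s, ∑ x, π x s = 1 / (k : ℝ)

/-- The expected score of a joint distribution `π` of token and side information. -/
def expectedScore {X : Type*} [Fintype X] {k : ℕ} (π c : X → Fin k → ℝ) : ℝ :=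
  ∑ x, ∑ s, π x s * c x s

/-- `π` solves the optimal transport problem with score matrix `c` (transport cost `-c`): it is
a coupling of `p` and the uniform distribution that maximizes the expected score. -/
def IsOTSolution {X : Type*} [Fintype X] (p : X → ℝ) (k : ℕ) (c π : X → Fin k → ℝ) : Prop :=
  IsUniformCoupling p k π ∧
    ∀ π' : X → Fin k → ℝ, IsUniformCoupling p k π' → expectedScore π' c ≤ expectedScore π c

/-- The token `x` is selected by the Gumbel watermark with token distribution `p` and Gumbel
side information `g`: it maximizes `log (p x) + g x`, where tokens of probability `0` have
`log 0 = -∞` and are never selected. -/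
def IsGumbelToken {X : Type*} (p g : X → ℝ) (x : X) : Prop :=
  0 < p x ∧ ∀ y, 0 < p y → Real.log (p y) + g y ≤ Real.log (p x) + g x

/-- In terms of the uniform variables `u x` that generate the Gumbel variables as
`g x = -log (-log (u x))`, the selected token is the one that minimizes `-log (u x) / p x`,
that is, the one that maximizes `(u x) ^ (1 / p x)`. -/
theorem isGumbelToken_iff_uniform {X : Type*} (p u : X → ℝ) (hu : ∀ x, 0 < u x ∧ u x < 1)
    (x : X) :
    IsGumbelToken p (fun y => -Real.log (-Real.log (u y))) x ↔
      0 < p x ∧ ∀ y, 0 < p y → -Real.log (u x) / p x ≤ -Real.log (u y) / p y := by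
  have hl : ∀ y, 0 < -Real.log (u y) := fun y => by
    have := Real.log_neg (hu y).1 (hu y).2
    linarith
  unfold IsGumbelToken
  refine and_congr_right fun hx => forall_congr' fun y => imp_congr_right fun hy => ?_
  rw [← Real.log_le_log_iff (div_pos (hl x) hx) (div_pos (hl y) hy),
    Real.log_div (hl x).ne' hx.ne', Real.log_div (hl y).ne' hy.ne']
  constructor <;> intro h <;> linarith

open Classical in
/-- The watermarked distribution `P(x | g)` of the Gumbel watermark given the side
information `g`: all the mass is put on the selected token (ties have probability zero). -/
noncomputable def gumbelWatermark {X : Type*} (p g : X → ℝ) (x : X) : ℝ :=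
  if IsGumbelToken p g x then 1 else 0

/-!
Write `log p x + g x` for the perturbed log-probability of a token. Its maximum over the tokens of
positive probability minus its value at `x` is the *deficit* `D(x, g) ≥ 0`, which vanishes exactly
when the Gumbel watermark may select `x`. For a coupling with the prescribed marginals, expected
score plus expected deficit is a constant (`IsUniformCoupling.sum_mul_tokenDeficit`): the terms
`log p x` see only the token marginal and the maxima only the side information marginal. Hence an
optimal coupling minimizes the expected deficit.

The watermark coupling has expected deficit zero, but its token marginal is the empirical frequency
`q` of the selected tokens, not `p`. By the Gumbel-max trick (`measure_isGumbelToken`) and the law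
of large numbers, `q → p` almost surely. Following the watermark with a probability `t → 1` such
that `t q ≤ p`, and otherwise drawing the token independently with weights `p - t q`, gives a true
coupling. Its expected deficit is `∑ x, (p x - t q x)` times the average deficit of `x`, which tends
to zero because the deficit is integrable. So the expected deficit of the optimal couplings tends
to zero as well (`tendsto_sum_mul_tokenDeficit`).

It remains to pass from a vanishing expected deficit to vanishing mass outside the selected token,
and from a vanishing `ℓ¹` distance to convergence against unbounded integrable test functions. Both
are instances of `ae_tendsto_weighted_sum_zero`, which applies because couplings have entries at
most `1 / k`, so that mass on rare side information is controlled by the law of large numbers.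

Almost sure uniqueness of the selected token needs no separate study of ties: the number of
maximizers is at least one and has mean `∑ x, p x = 1`.
-/

/-! ### The Gumbel distribution -/

/-- The Gumbel density is at most `2 e^{-|t|}`: on the right because of the factor `e^{-t}`, on the
left because of the double exponential. -/
theorem abs_mul_gumbelPDFReal_le (t : ℝ) : |t| * gumbelPDFReal t ≤ 12 * (1 + t ^ 2)⁻¹ := by
  -- the cubic Taylor polynomial of `exp` dominates `a (1 + a ^ 2) / 6`
  have key : ∀ a : ℝ, 0 ≤ a → a * Real.exp (-a) ≤ 6 * (1 + a ^ 2)⁻¹ := by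
    intro a ha
    have h := Real.sum_le_exp_of_nonneg ha 4
    simp only [Finset.sum_range_succ, Finset.sum_range_zero, Nat.factorial] at h
    norm_num at h
    rw [Real.exp_neg, ← div_eq_mul_inv, ← div_eq_mul_inv,
      div_le_div_iff₀ (Real.exp_pos a) (by positivity)]
    nlinarith [sq_nonneg a]
  have hpdf : gumbelPDFReal t ≤ 2 * Real.exp (-|t|) := by
    unfold gumbelPDFReal
    rcases le_total 0 t with ht | ht
    · rw [abs_of_nonneg ht]
      have : Real.exp (-(t + Real.exp (-t))) ≤ Real.exp (-t) :=
        Real.exp_le_exp.2 (by linarith [Real.exp_pos (-t)])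
      linarith [Real.exp_pos (-t)]
    · rw [abs_of_nonpos ht, neg_neg, neg_add, Real.exp_add, Real.exp_neg (Real.exp (-t)),
        ← div_eq_mul_inv, div_le_iff₀ (Real.exp_pos _)]
      -- with `u = e^{-t}` this is `u ≤ (2 / u) * e^u`, a consequence of `u ^ 2 / 2 ≤ e^u`
      have h := Real.quadratic_le_exp_of_nonneg (Real.exp_pos (-t)).le
      have h1 : Real.exp t * Real.exp (-t) = 1 := by rw [← Real.exp_add]; simp
      have hp := Real.exp_pos t
      have hu := Real.exp_pos (-t)
      calc Real.exp (-t) = 2 * Real.exp t * (Real.exp (-t) ^ 2 / 2) := by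
            linear_combination (-Real.exp (-t)) * h1
        _ ≤ 2 * Real.exp t * Real.exp (Real.exp (-t)) := by gcongr; linarith
  calc |t| * gumbelPDFReal t ≤ |t| * (2 * Real.exp (-|t|)) := by gcongr
    _ = 2 * (|t| * Real.exp (-|t|)) := by ring
    _ ≤ 2 * (6 * (1 + |t| ^ 2)⁻¹) := by
        have := key _ (abs_nonneg t)
        linarith
    _ = 12 * (1 + t ^ 2)⁻¹ := by rw [sq_abs]; ring

theorem integrable_id_gumbelMeasure : Integrable (fun t : ℝ => t) gumbelMeasure := by
  have hm : Measurable gumbelPDFReal := continuous_gumbelPDFReal.measurable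
  rw [gumbelMeasure, integrable_withDensity_iff_integrable_smul₀' (by fun_prop) (by simp)]
  refine (integrable_inv_one_add_sq.const_mul 12).mono' (by fun_prop) (ae_of_all _ fun t => ?_)
  rw [ENNReal.toReal_ofReal (gumbelPDFReal_nonneg t), norm_smul,
    Real.norm_of_nonneg (gumbelPDFReal_nonneg t), Real.norm_eq_abs, mul_comm]
  exact abs_mul_gumbelPDFReal_le t

/-- Reweighting by `exp (-(1 / q - 1) e^{-t})`, the probability that rival tokens of total mass
`1 - q` all lose against the score `t` of a token of mass `q`, turns the Gumbel density into `q`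
times a shifted Gumbel density. -/
theorem lintegral_gumbelMeasure_exp {q : ℝ} (hq : 0 < q) :
    ∫⁻ t, ENNReal.ofReal (Real.exp (-((1 / q - 1) * Real.exp (-t)))) ∂gumbelMeasure
      = ENNReal.ofReal q := by
  have hm : Measurable gumbelPDFReal := continuous_gumbelPDFReal.measurable
  have hone : ∫⁻ t, ENNReal.ofReal (gumbelPDFReal t) = 1 := by
    have := measure_univ (μ := gumbelMeasure)
    rwa [gumbelMeasure, withDensity_apply _ MeasurableSet.univ, Measure.restrict_univ] at this
  rw [gumbelMeasure, lintegral_withDensity_eq_lintegral_mul _ (by fun_prop) (by fun_prop)]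
  have : ∀ t : ℝ, ((fun t => ENNReal.ofReal (gumbelPDFReal t)) * fun t =>
      ENNReal.ofReal (Real.exp (-((1 / q - 1) * Real.exp (-t))))) t
      = ENNReal.ofReal q * ENNReal.ofReal (gumbelPDFReal (t + Real.log q)) := by
    intro t
    rw [Pi.mul_apply, ← ENNReal.ofReal_mul (gumbelPDFReal_nonneg t), ← ENNReal.ofReal_mul hq.le]
    congr 1
    have h1 : Real.exp (-(t + Real.log q)) = Real.exp (-t) / q := by
      rw [neg_add, Real.exp_add, Real.exp_neg (Real.log q), Real.exp_log hq, div_eq_mul_inv]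
    unfold gumbelPDFReal
    rw [neg_add (t + Real.log q), Real.exp_add (-(t + Real.log q)), h1, ← Real.exp_add,
      ← mul_assoc, mul_div_cancel₀ _ hq.ne', ← Real.exp_add]
    congr 1
    ring
  simp_rw [this]
  rw [lintegral_const_mul _ (by fun_prop),
    lintegral_add_right_eq_self (fun t => ENNReal.ofReal (gumbelPDFReal t)), hone, mul_one]

/-! ### The token selected by the Gumbel watermark -/

theorem measurableSet_isGumbelToken {X : Type*} [Fintype X] (p : X → ℝ) (x : X) :
    MeasurableSet {g : X → ℝ | IsGumbelToken p g x} := by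
  have : {g : X → ℝ | IsGumbelToken p g x} = {_g | 0 < p x} ∩
      ⋂ y, ⋂ _ : 0 < p y, {g | Real.log (p y) + g y ≤ Real.log (p x) + g x} := by
    ext g; simp [IsGumbelToken]
  rw [this]
  exact (MeasurableSet.const _).inter (MeasurableSet.iInter fun y => MeasurableSet.iInter fun _ =>
    measurableSet_le (by fun_prop) (by fun_prop))

theorem exists_isGumbelToken {X : Type*} [Fintype X] {p : X → ℝ} (hp : p ∈ stdSimplex ℝ X)
    (g : X → ℝ) : ∃ x, IsGumbelToken p g x := by
  classical
  have hne : (Finset.univ.filter fun x => 0 < p x).Nonempty := by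
    by_contra h
    rw [Finset.not_nonempty_iff_eq_empty, Finset.filter_eq_empty_iff] at h
    have : ∑ x, p x ≤ 0 := Finset.sum_nonpos fun x hx => not_lt.1 (h hx)
    linarith [hp.2]
  obtain ⟨x, hx, hmax⟩ := Finset.exists_max_image _ (fun x => Real.log (p x) + g x) hne
  exact ⟨x, (Finset.mem_filter.1 hx).2, fun y hy => hmax y (by simp [hy])⟩

/-- The Gumbel-max trick: conditionally on the score `t` of `x`, the rivals lose independently
with probabilities `exp (-(p y / p x) e^{-t})`, and these multiply to
`exp (-(1 / p x - 1) e^{-t})`. -/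
theorem measure_isGumbelToken {X : Type*} [Fintype X] {p : X → ℝ} (hp : p ∈ stdSimplex ℝ X)
    (x : X) : (Measure.pi fun _ : X => gumbelMeasure) {g | IsGumbelToken p g x}
      = ENNReal.ofReal (p x) := by
  classical
  rcases (hp.1 x).eq_or_lt with h0 | hx
  · simp [IsGumbelToken, ← h0]
  have hmp := (measurePreserving_piEquivPiSubtypeProd (fun _ : X => gumbelMeasure) (· = x))
  set B : Set (({y // y = x} → ℝ) × ({y // ¬ y = x} → ℝ)) :=
    {z | ∀ y : {y // ¬ y = x}, 0 < p y → Real.log (p y) + z.2 y ≤ Real.log (p x) + z.1 ⟨x, rfl⟩}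
    with hB
  have hBm : MeasurableSet B := by
    have : B = ⋂ y : {y // ¬ y = x}, ⋂ _ : 0 < p y,
        {z | Real.log (p y) + z.2 y ≤ Real.log (p x) + z.1 ⟨x, rfl⟩} := by
      ext; simp [hB]
    rw [this]
    exact MeasurableSet.iInter fun y => MeasurableSet.iInter fun _ =>
      measurableSet_le (by fun_prop) (by fun_prop)
  have hpre : {g | IsGumbelToken p g x}
      = (MeasurableEquiv.piEquivPiSubtypeProd (fun _ : X => ℝ) (· = x)) ⁻¹' B := by
    ext g
    simp only [IsGumbelToken, hx, true_and, hB, Set.mem_preimage, Set.mem_ofPred_eq]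
    constructor
    · intro h y hy
      exact h y hy
    · intro h y hy
      by_cases hyx : y = x
      · rw [hyx]
      · exact h ⟨y, hyx⟩ hy
  rw [hpre, hmp.measure_preimage hBm.nullMeasurableSet, Measure.prod_apply hBm,
    ← lintegral_gumbelMeasure_exp hx]
  have hslice : ∀ a : {y // y = x} → ℝ,
      (Measure.pi fun _ : {y // ¬ y = x} => gumbelMeasure) (Prod.mk a ⁻¹' B)
        = ENNReal.ofReal (Real.exp (-((1 / p x - 1) * Real.exp (-(a ⟨x, rfl⟩))))) := by
    intro a
    have hset : Prod.mk a ⁻¹' B = Set.univ.pi fun y : {y // ¬ y = x} =>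
        if 0 < p y then Set.Iic (Real.log (p x) - Real.log (p y) + a ⟨x, rfl⟩) else Set.univ := by
      ext b
      simp only [hB, Set.mem_preimage, Set.mem_ofPred_eq, Set.mem_univ_pi]
      refine forall_congr' fun y => ?_
      split_ifs with hy
      · simp only [hy, true_imp_iff, Set.mem_Iic]
        constructor <;> intro h <;> linarith
      · simp [hy]
    have hfac : ∀ y : {y // ¬ y = x}, gumbelMeasure (if 0 < p y then
        Set.Iic (Real.log (p x) - Real.log (p y) + a ⟨x, rfl⟩) else Set.univ)
        = ENNReal.ofReal (Real.exp (-(p y / p x * Real.exp (-(a ⟨x, rfl⟩))))) := by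
      intro y
      split_ifs with hy
      · rw [gumbelMeasure_Iic]
        have : Real.exp (-(Real.log (p x) - Real.log (p y) + a ⟨x, rfl⟩))
            = p y / p x * Real.exp (-(a ⟨x, rfl⟩)) := by
          rw [neg_add, Real.exp_add, neg_sub, Real.exp_sub, Real.exp_log hx, Real.exp_log hy]
        rw [this]
      · have : p y = 0 := le_antisymm (not_lt.1 hy) (hp.1 y)
        simp [this]
    rw [hset, Measure.pi_pi]
    simp_rw [hfac]
    rw [← ENNReal.ofReal_prod_of_nonneg fun _ _ => (Real.exp_pos _).le, ← Real.exp_sum,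
      Finset.sum_neg_distrib, ← Finset.sum_mul, ← Finset.sum_div]
    have hsum : ∑ y : {y // ¬ y = x}, p y = 1 - p x := by
      have h := Fintype.sum_subtype_add_sum_subtype (· = x) p
      have h1 : ∀ I : Fintype {y // y = x},
          (@Finset.sum _ _ _ (@Finset.univ _ I) fun y => p y) = p x :=
        fun I => Fintype.sum_unique _
      rw [hp.2, h1] at h
      linarith
    rw [hsum, sub_div, div_self hx.ne']
  simp_rw [hslice]
  refine MeasurePreserving.lintegral_comp (g := fun a : {y // y = x} → ℝ => a ⟨x, rfl⟩)
    (f := fun t => ENNReal.ofReal (Real.exp (-((1 / p x - 1) * Real.exp (-t))))) ?_ (by fun_prop)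
  convert measurePreserving_eval (fun _ : {y // y = x} => gumbelMeasure) ⟨x, rfl⟩

theorem gumbelWatermark_nonneg {X : Type*} (p g : X → ℝ) (x : X) : 0 ≤ gumbelWatermark p g x := by
  unfold gumbelWatermark; split_ifs <;> norm_num

theorem gumbelWatermark_le_one {X : Type*} (p g : X → ℝ) (x : X) : gumbelWatermark p g x ≤ 1 := by
  unfold gumbelWatermark; split_ifs <;> norm_num

theorem gumbelWatermark_eq_indicator {X : Type*} (p : X → ℝ) (x : X) :
    (fun g => gumbelWatermark p g x) = {g | IsGumbelToken p g x}.indicator 1 := by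
  classical
  ext g
  simp [gumbelWatermark, Set.indicator_apply]

theorem measurable_gumbelWatermark {X : Type*} [Fintype X] (p : X → ℝ) (x : X) :
    Measurable fun g => gumbelWatermark p g x := by
  rw [gumbelWatermark_eq_indicator]
  exact measurable_one.indicator (measurableSet_isGumbelToken p x)

theorem integrable_gumbelWatermark {X : Type*} [Fintype X] (p : X → ℝ) (x : X) :
    Integrable (fun g => gumbelWatermark p g x) (Measure.pi fun _ : X => gumbelMeasure) := by
  rw [gumbelWatermark_eq_indicator]
  exact (integrable_const (1 : ℝ)).indicator (measurableSet_isGumbelToken p x)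

theorem integral_gumbelWatermark {X : Type*} [Fintype X] {p : X → ℝ} (hp : p ∈ stdSimplex ℝ X)
    (x : X) : ∫ g, gumbelWatermark p g x ∂(Measure.pi fun _ : X => gumbelMeasure) = p x := by
  rw [gumbelWatermark_eq_indicator, integral_indicator_one (measurableSet_isGumbelToken p x),
    measureReal_def, measure_isGumbelToken hp, ENNReal.toReal_ofReal (hp.1 x)]

/-- The number of selected tokens is at least one, and its expectation is `∑ x, p x = 1` by the
Gumbel-max trick; so it is almost surely one. -/
theorem ae_sum_gumbelWatermark_eq_one {X : Type*} [Fintype X] {p : X → ℝ}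
    (hp : p ∈ stdSimplex ℝ X) :
    ∀ᵐ g ∂(Measure.pi fun _ : X => gumbelMeasure), ∑ x, gumbelWatermark p g x = 1 := by
  have hint : Integrable (fun g => ∑ x, gumbelWatermark p g x)
      (Measure.pi fun _ : X => gumbelMeasure) :=
    integrable_finsetSum _ fun x _ => integrable_gumbelWatermark p x
  have hnn : ∀ g : X → ℝ, 0 ≤ ∑ x, gumbelWatermark p g x - 1 := by
    intro g
    obtain ⟨x, hx⟩ := exists_isGumbelToken hp g
    have h1 : gumbelWatermark p g x = 1 := if_pos hx
    have := Finset.single_le_sum (fun y _ => gumbelWatermark_nonneg p g y) (Finset.mem_univ x)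
    linarith
  have h0 : ∫ g, (∑ x, gumbelWatermark p g x - 1) ∂(Measure.pi fun _ : X => gumbelMeasure)
      = 0 := by
    rw [integral_sub hint (integrable_const _),
      integral_finsetSum _ fun x _ => integrable_gumbelWatermark p x]
    simp [integral_gumbelWatermark hp, hp.2]
  have := (integral_eq_zero_iff_of_nonneg hnn (hint.sub (integrable_const _))).1 h0
  filter_upwards [this] with g hg
  simp only [Pi.zero_apply] at hg
  linarith

theorem existsUnique_isGumbelToken_of_sum_eq_one {X : Type*} [Fintype X] {p g : X → ℝ}
    (h : ∑ x, gumbelWatermark p g x = 1) : ∃! x, IsGumbelToken p g x := by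
  classical
  have hc : ∑ x, gumbelWatermark p g x = ((Finset.univ.filter (IsGumbelToken p g)).card : ℝ) := by
    simp [gumbelWatermark]
  rw [hc, Nat.cast_eq_one, Finset.card_eq_one] at h
  obtain ⟨x, hx⟩ := h
  have : ∀ y, IsGumbelToken p g y ↔ y = x := fun y => by
    simpa using congrArg (y ∈ ·) hx
  exact ⟨x, (this x).2 rfl, fun y hy => (this y).1 hy⟩

/-! ### Empirical averages of an i.i.d. sequence -/

/-- The strong law of large numbers for an integrable function of independent samples; the
function is only almost everywhere measurable, and `s` runs through `Fin k`. -/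
theorem ae_tendsto_average {Ω E : Type*} [MeasurableSpace Ω] [MeasurableSpace E] {P : Measure Ω}
    {μ : Measure E} {g : ℕ → Ω → E} (hlaw : ∀ s, HasLaw (g s) μ P)
    (hind : Pairwise fun s t => IndepFun (g s) (g t) P) {h : E → ℝ} (hh : Integrable h μ) :
    ∀ᵐ ω ∂P, Tendsto (fun k : ℕ => 1 / (k : ℝ) * ∑ s : Fin k, h (g s ω)) atTop
      (𝓝 (∫ e, h e ∂μ)) := by
  have hm : ∀ s, AEMeasurable h (P.map (g s)) := fun s => by
    rw [(hlaw s).map_eq]; exact hh.aemeasurable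
  have hmap : ∀ s, P.map (h ∘ g s) = μ.map h := fun s => by
    rw [← AEMeasurable.map_map_of_aemeasurable (hm s) (hlaw s).aemeasurable, (hlaw s).map_eq]
  have hae : ∀ s, AEMeasurable (h ∘ g s) P := fun s =>
    (hm s).comp_aemeasurable (hlaw s).aemeasurable
  have h0 : Integrable (h ∘ g 0) P := by
    have : Integrable h (P.map (g 0)) := by rwa [(hlaw 0).map_eq]
    exact this.comp_aemeasurable (hlaw 0).aemeasurable
  have key := strong_law_ae_real (fun s => h ∘ g s) h0
    (fun s t hst => (hind hst).comp₀ (hlaw s).aemeasurable (hlaw t).aemeasurable (hm s) (hm t))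
    (fun s => ⟨hae s, hae 0, by rw [hmap, hmap]⟩)
  rw [(hlaw 0).integral_comp hh.aestronglyMeasurable] at key
  filter_upwards [key] with ω hω
  refine hω.congr fun k => ?_
  rw [← Fin.sum_univ_eq_sum_range (fun s => (h ∘ g s) ω) k, div_eq_mul_inv, mul_comm, one_div]
  rfl

/-- Domination of limits under small weights: if the weights `a k x s ∈ [0, 1 / k]`
asymptotically do not charge `v ≥ 0`, then they do not charge any integrable `u ≥ 0` that
vanishes where `v` does. Indeed `u ≤ n v + (u - n v)⁺`, and the last term has small expectation for
large `n`. -/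
theorem ae_tendsto_weighted_sum_zero {Ω E X : Type*} [Fintype X] [MeasurableSpace Ω]
    [MeasurableSpace E] {P : Measure Ω} {μ : Measure E} {g : ℕ → Ω → E}
    (hlaw : ∀ s, HasLaw (g s) μ P) (hind : Pairwise fun s t => IndepFun (g s) (g t) P)
    {u v : X → E → ℝ} (hu : ∀ x, Integrable (u x) μ) (hv : ∀ x, AEStronglyMeasurable (v x) μ)
    (hu0 : ∀ x e, 0 ≤ u x e) (hv0 : ∀ x e, 0 ≤ v x e) (huv : ∀ x e, v x e = 0 → u x e = 0) :
    ∀ᵐ ω ∂P, ∀ a : (k : ℕ) → X → Fin k → ℝ,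
      (∀ᶠ k in atTop, ∀ x s, 0 ≤ a k x s ∧ a k x s ≤ 1 / (k : ℝ)) →
      Tendsto (fun k : ℕ => ∑ x, ∑ s : Fin k, a k x s * v x (g s ω)) atTop (𝓝 0) →
      Tendsto (fun k : ℕ => ∑ x, ∑ s : Fin k, a k x s * u x (g s ω)) atTop (𝓝 0) := by
  set h : ℕ → X → E → ℝ := fun n x e => max (u x e - n * v x e) 0 with hdef
  have hle : ∀ n x e, h n x e ≤ u x e := fun n x e =>
    max_le (by have := mul_nonneg n.cast_nonneg (hv0 x e); linarith) (hu0 x e)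
  have hnn : ∀ n x e, 0 ≤ h n x e := fun n x e => le_max_right _ _
  have hmeas : ∀ n x, AEStronglyMeasurable (h n x) μ := fun n x =>
    ((hu x).aestronglyMeasurable.sub ((hv x).const_mul _)).sup aestronglyMeasurable_const
  have hbd : ∀ n x e, ‖h n x e‖ ≤ u x e := fun n x e => by
    rw [Real.norm_of_nonneg (hnn n x e)]; exact hle n x e
  have hint : ∀ n x, Integrable (h n x) μ := fun n x =>
    (hu x).mono' (hmeas n x) (ae_of_all _ (hbd n x))
  have hlim : Tendsto (fun n : ℕ => ∑ x, ∫ e, h n x e ∂μ) atTop (𝓝 0) := by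
    rw [← Finset.sum_const_zero (s := (Finset.univ : Finset X))]
    refine tendsto_finsetSum _ fun x _ => ?_
    rw [← integral_zero E ℝ (μ := μ)]
    refine tendsto_integral_of_dominated_convergence (u x) (hmeas · x) (hu x)
      (fun n => ae_of_all _ (hbd n x)) (ae_of_all _ fun e => ?_)
    rcases (hv0 x e).eq_or_lt with h0 | hpos
    · simp [hdef, ← h0, huv x e h0.symm]
    · obtain ⟨N, hN⟩ := exists_nat_ge (u x e / v x e)
      refine tendsto_const_nhds.congr' ?_
      filter_upwards [eventually_ge_atTop N] with n hn
      have : u x e ≤ n * v x e := by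
        rw [← div_le_iff₀ hpos]; exact hN.trans (by exact_mod_cast hn)
      exact (max_eq_right (by linarith)).symm
  have hS : ∀ᵐ ω ∂P, ∀ n x, Tendsto (fun k : ℕ => 1 / (k : ℝ) * ∑ s : Fin k, h n x (g s ω)) atTop
      (𝓝 (∫ e, h n x e ∂μ)) := by
    rw [ae_all_iff]; intro n
    rw [ae_all_iff]; intro x
    exact ae_tendsto_average hlaw hind (hint n x)
  filter_upwards [hS] with ω hω a ha hav
  rw [Metric.tendsto_atTop']
  intro ε hε
  obtain ⟨n, hn⟩ := (hlim.eventually_lt_const hε).exists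
  have hlim2 : Tendsto (fun k : ℕ => n * (∑ x, ∑ s : Fin k, a k x s * v x (g s ω))
      + ∑ x, 1 / (k : ℝ) * ∑ s : Fin k, h n x (g s ω)) atTop
      (𝓝 (n * 0 + ∑ x, ∫ e, h n x e ∂μ)) :=
    (hav.const_mul _).add (tendsto_finsetSum _ fun x _ => hω n x)
  rw [mul_zero, zero_add] at hlim2
  obtain ⟨K, hK⟩ := eventually_atTop.1 ((hlim2.eventually_lt_const hn).and ha)
  refine ⟨K, fun k hk => ?_⟩
  obtain ⟨h1, h2⟩ := hK k hk.le
  rw [Real.dist_eq, sub_zero, abs_of_nonneg (Finset.sum_nonneg fun x _ =>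
    Finset.sum_nonneg fun s _ => mul_nonneg (h2 x s).1 (hu0 _ _))]
  refine lt_of_le_of_lt ?_ h1
  simp only [Finset.mul_sum, ← Finset.sum_add_distrib]
  refine Finset.sum_le_sum fun x _ => Finset.sum_le_sum fun s _ => ?_
  have e1 : u x (g s ω) ≤ n * v x (g s ω) + h n x (g s ω) := by
    have := le_max_left (u x (g s ω) - n * v x (g s ω)) 0
    simp only [hdef]; linarith
  calc a k x s * u x (g s ω) ≤ a k x s * (n * v x (g s ω) + h n x (g s ω)) :=
        mul_le_mul_of_nonneg_left e1 (h2 x s).1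
    _ = n * (a k x s * v x (g s ω)) + a k x s * h n x (g s ω) := by ring
    _ ≤ _ := by
        have := mul_le_mul_of_nonneg_right (h2 x s).2 (hnn n x (g s ω))
        linarith

theorem hasLaw_score_vector {X Ω : Type*} [Fintype X] [MeasurableSpace Ω] {P : Measure Ω}
    [IsProbabilityMeasure P] {ν : Measure ℝ} {f : X → ℕ → Ω → ℝ}
    (hindep : iIndepFun (fun i : X × ℕ => f i.1 i.2) P) (hlaw : ∀ x s, HasLaw (f x s) ν P)
    (s : ℕ) : HasLaw (fun ω x => f x s ω) (Measure.pi fun _ : X => ν) P where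
  aemeasurable := aemeasurable_pi_lambda _ fun x => (hlaw x s).aemeasurable
  map_eq := by
    have h : iIndepFun (fun x => f x s) P :=
      hindep.precomp (g := fun x : X => (x, s)) fun x y hxy => (Prod.mk.inj hxy).1
    rw [(iIndepFun_iff_map_fun_eq_pi_map fun x => (hlaw x s).aemeasurable).1 h]
    simp_rw [fun x => (hlaw x s).map_eq]

theorem pairwise_indepFun_score_vector {X Ω : Type*} [Fintype X] [MeasurableSpace Ω]
    {P : Measure Ω} {f : X → ℕ → Ω → ℝ} (hindep : iIndepFun (fun i : X × ℕ => f i.1 i.2) P)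
    (hm : ∀ x s, AEMeasurable (f x s) P) :
    Pairwise fun s t => IndepFun (fun ω x => f x s ω) (fun ω x => f x t ω) P := by
  classical
  intro s t hst
  have hdisj : Disjoint (Finset.univ ×ˢ {s} : Finset (X × ℕ)) (Finset.univ ×ˢ {t}) := by
    rw [Finset.disjoint_left]
    rintro ⟨x, i⟩ h1 h2
    simp only [Finset.mem_product, Finset.mem_singleton, Finset.mem_univ, true_and] at h1 h2
    exact hst (h1.symm.trans h2)
  have h := hindep.indepFun_finset₀ _ _ hdisj fun i => hm i.1 i.2
  have hφ : Measurable fun (z : (Finset.univ ×ˢ {s} : Finset (X × ℕ)) → ℝ) (x : X) =>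
      z ⟨(x, s), by simp⟩ := by fun_prop
  have hψ : Measurable fun (z : (Finset.univ ×ˢ {t} : Finset (X × ℕ)) → ℝ) (x : X) =>
      z ⟨(x, t), by simp⟩ := by fun_prop
  exact h.comp hφ hψ

/-! ### The deficit of a token -/

/-- The largest perturbed log-probability `log (p y) + g y` over the tokens of positive
probability. -/
noncomputable def maxPerturbedLogit {X : Type*} (p g : X → ℝ) : ℝ :=
  ⨆ y : {y // 0 < p y}, (Real.log (p y) + g y)

/-- The amount by which the perturbed log-probability of `x` falls short of the maximum. It is
set to zero for tokens of probability zero, which no coupling charges. -/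
noncomputable def tokenDeficit {X : Type*} (p g : X → ℝ) (x : X) : ℝ :=
  if 0 < p x then maxPerturbedLogit p g - (Real.log (p x) + g x) else 0

theorem le_maxPerturbedLogit {X : Type*} [Finite X] {p : X → ℝ} (g : X → ℝ) {x : X}
    (hx : 0 < p x) : Real.log (p x) + g x ≤ maxPerturbedLogit p g :=
  le_ciSup (f := fun y : {y // 0 < p y} => Real.log (p y) + g y) (Set.finite_range _).bddAbove
    ⟨x, hx⟩

theorem IsGumbelToken.maxPerturbedLogit_eq {X : Type*} [Finite X] {p g : X → ℝ} {x : X}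
    (h : IsGumbelToken p g x) : maxPerturbedLogit p g = Real.log (p x) + g x := by
  have : Nonempty {y // 0 < p y} := ⟨⟨x, h.1⟩⟩
  exact le_antisymm (ciSup_le fun y => h.2 y y.2) (le_maxPerturbedLogit g h.1)

theorem tokenDeficit_nonneg {X : Type*} [Finite X] (p g : X → ℝ) (x : X) :
    0 ≤ tokenDeficit p g x := by
  unfold tokenDeficit
  split_ifs with h
  · exact sub_nonneg.2 (le_maxPerturbedLogit g h)
  · exact le_rfl

theorem tokenDeficit_eq_zero_iff {X : Type*} [Finite X] {p g : X → ℝ} {x : X} (hx : 0 < p x) :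
    tokenDeficit p g x = 0 ↔ IsGumbelToken p g x := by
  rw [tokenDeficit, if_pos hx, sub_eq_zero]
  exact ⟨fun h => ⟨hx, fun y hy => h ▸ le_maxPerturbedLogit g hy⟩, fun h => h.maxPerturbedLogit_eq⟩

theorem gumbelWatermark_mul_tokenDeficit {X : Type*} [Finite X] (p g : X → ℝ) (x : X) :
    gumbelWatermark p g x * tokenDeficit p g x = 0 := by
  by_cases h : IsGumbelToken p g x
  · rw [(tokenDeficit_eq_zero_iff h.1).2 h, mul_zero]
  · rw [gumbelWatermark, if_neg h, zero_mul]

theorem measurable_tokenDeficit {X : Type*} [Finite X] (p : X → ℝ) (x : X) :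
    Measurable fun g => tokenDeficit p g x := by
  have hM : Measurable fun g : X → ℝ => maxPerturbedLogit p g :=
    Measurable.iSup fun y => by fun_prop
  unfold tokenDeficit
  split_ifs
  · exact hM.sub (by fun_prop)
  · exact measurable_const

theorem integrable_tokenDeficit {X : Type*} [Fintype X] {p : X → ℝ} (hp : p ∈ stdSimplex ℝ X)
    (x : X) : Integrable (fun g => tokenDeficit p g x) (Measure.pi fun _ : X => gumbelMeasure) := by
  have hi : ∀ y, Integrable (fun g : X → ℝ => |Real.log (p y) + g y|)
      (Measure.pi fun _ : X => gumbelMeasure) := fun y =>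
    ((integrable_const _).add (integrable_comp_eval (μ := fun _ : X => gumbelMeasure) (i := y)
      integrable_id_gumbelMeasure)).abs
  refine ((integrable_finsetSum Finset.univ fun y _ => hi y).add (hi x)).mono'
    (measurable_tokenDeficit p x).aestronglyMeasurable (ae_of_all _ fun g => ?_)
  have hs : ∀ y, |Real.log (p y) + g y| ≤ ∑ y, |Real.log (p y) + g y| := fun y =>
    Finset.single_le_sum (f := fun y => |Real.log (p y) + g y|) (fun _ _ => abs_nonneg _)
      (Finset.mem_univ y)
  rw [Real.norm_of_nonneg (tokenDeficit_nonneg p g x), Pi.add_apply, tokenDeficit]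
  split_ifs with h
  · obtain ⟨y, hy⟩ := exists_isGumbelToken hp g
    rw [hy.maxPerturbedLogit_eq]
    linarith [hs y, le_abs_self (Real.log (p y) + g y), neg_abs_le (Real.log (p x) + g x)]
  · linarith [hs x, abs_nonneg (Real.log (p x) + g x)]

/-! ### Couplings and the optimal transport problem -/

theorem IsUniformCoupling.eq_zero {X : Type*} [Fintype X] {p : X → ℝ} {k : ℕ}
    {π : X → Fin k → ℝ} (h : IsUniformCoupling p k π) {x : X} (hx : p x = 0) (s : Fin k) :
    π x s = 0 :=
  (Finset.sum_eq_zero_iff_of_nonneg fun s _ => h.nonneg x s).1 ((h.sum_right x).trans hx) s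
    (Finset.mem_univ s)

theorem IsUniformCoupling.le_one_div {X : Type*} [Fintype X] {p : X → ℝ} {k : ℕ}
    {π : X → Fin k → ℝ} (h : IsUniformCoupling p k π) (x : X) (s : Fin k) :
    π x s ≤ 1 / (k : ℝ) := by
  rw [← h.sum_left s]
  exact Finset.single_le_sum (f := fun x => π x s) (fun x _ => h.nonneg x s) (Finset.mem_univ x)

theorem exists_isOTSolution {X : Type*} [Fintype X] {p : X → ℝ} (hp : p ∈ stdSimplex ℝ X)
    {k : ℕ} (hk : 0 < k) (c : X → Fin k → ℝ) : ∃ π, IsOTSolution p k c π := by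
  have hk' : (k : ℝ) ≠ 0 := by positivity
  have hsub : {π | IsUniformCoupling p k π} ⊆
      Set.univ.pi fun _ : X => Set.univ.pi fun _ : Fin k => Set.Icc (0 : ℝ) (1 / k) :=
    fun π h x _ s _ => ⟨h.nonneg x s, h.le_one_div x s⟩
  have hclosed : IsClosed {π | IsUniformCoupling p k π} := by
    have : {π | IsUniformCoupling p k π} = {π | ∀ x s, 0 ≤ π x s} ∩
        ({π | ∀ x, ∑ s, π x s = p x} ∩ {π | ∀ s, ∑ x, π x s = 1 / (k : ℝ)}) := by
      ext π
      exact ⟨fun h => ⟨h.1, h.2, h.3⟩, fun h => ⟨h.1, h.2.1, h.2.2⟩⟩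
    rw [this]
    simp only [Set.ofPred_forall]
    refine (isClosed_iInter fun x => isClosed_iInter fun s =>
      isClosed_le continuous_const (by fun_prop)).inter
      ((isClosed_iInter fun x => isClosed_eq (by fun_prop) continuous_const).inter
        (isClosed_iInter fun s => isClosed_eq (by fun_prop) continuous_const))
  have hcomp : IsCompact {π | IsUniformCoupling p k π} :=
    (isCompact_univ_pi fun _ => isCompact_univ_pi fun _ => isCompact_Icc).of_isClosed_subset
      hclosed hsub
  have hne : {π | IsUniformCoupling p k π}.Nonempty := by
    refine ⟨fun x _ => p x / k, fun x s => div_nonneg (hp.1 x) k.cast_nonneg, fun x => ?_,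
      fun s => ?_⟩
    · simp [mul_div_cancel₀ _ hk']
    · rw [← Finset.sum_div, hp.2]
  obtain ⟨π, hπ, hmax⟩ := hcomp.exists_isMaxOn hne
    (f := fun π => expectedScore π c) (by unfold expectedScore; fun_prop)
  exact ⟨π, hπ, fun π' h => hmax h⟩

/-- On couplings, the expected score and the expected deficit add up to a constant, so that an
optimal coupling minimizes the expected deficit. -/
theorem IsUniformCoupling.sum_mul_tokenDeficit {X : Type*} [Fintype X] {p : X → ℝ}
    (hp : ∀ x, 0 ≤ p x) {k : ℕ} {π : X → Fin k → ℝ} (h : IsUniformCoupling p k π)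
    (c : X → Fin k → ℝ) :
    ∑ x, ∑ s, π x s * tokenDeficit p (fun y => c y s) x
      = ∑ s, 1 / (k : ℝ) * maxPerturbedLogit p (fun y => c y s) - ∑ x, p x * Real.log (p x)
        - expectedScore π c := by
  have h1 : ∀ x s, π x s * tokenDeficit p (fun y => c y s) x
      = π x s * maxPerturbedLogit p (fun y => c y s) - π x s * Real.log (p x)
        - π x s * c x s := by
    intro x s
    rcases (hp x).eq_or_lt with h0 | hx
    · simp [h.eq_zero h0.symm s]
    · rw [tokenDeficit, if_pos hx]; ring
  simp_rw [h1, Finset.sum_sub_distrib]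
  rw [Finset.sum_comm, expectedScore]
  simp_rw [← Finset.sum_mul, h.sum_left, h.sum_right]

/-- The expected deficit of an optimal coupling is at most that of the coupling which follows the
Gumbel watermark with probability `t` and otherwise draws the token independently of the side
information, with the weights that correct the token distribution to `p`. -/
theorem IsOTSolution.sum_mul_tokenDeficit_le {X : Type*} [Fintype X] {p : X → ℝ}
    (hp : p ∈ stdSimplex ℝ X) {k : ℕ} (hk : 0 < k) {c π : X → Fin k → ℝ}
    (h : IsOTSolution p k c π) (huniq : ∀ s, ∑ x, gumbelWatermark p (fun y => c y s) x = 1)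
    {t : ℝ} (ht : 0 ≤ t)
    (hle : ∀ x, t * (1 / (k : ℝ) * ∑ s, gumbelWatermark p (fun y => c y s) x) ≤ p x) :
    ∑ x, ∑ s, π x s * tokenDeficit p (fun y => c y s) x
      ≤ ∑ x, (p x - t * (1 / (k : ℝ) * ∑ s, gumbelWatermark p (fun y => c y s) x))
        * (1 / (k : ℝ) * ∑ s, tokenDeficit p (fun y => c y s) x) := by
  have hk' : (k : ℝ) ≠ 0 := by positivity
  set W : X → Fin k → ℝ := fun x s => gumbelWatermark p (fun y => c y s) x
  set q : X → ℝ := fun x => 1 / (k : ℝ) * ∑ s, W x s with hq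
  have hqsum : ∑ x, q x = 1 := by
    rw [hq, ← Finset.mul_sum, Finset.sum_comm, Finset.sum_congr rfl fun s _ => huniq s]
    simp [hk']
  have hπ' : IsUniformCoupling p k fun x s => t * (1 / (k : ℝ) * W x s) + (p x - t * q x) / k := by
    refine ⟨fun x s => ?_, fun x => ?_, fun s => ?_⟩
    · exact add_nonneg (mul_nonneg ht (mul_nonneg (by positivity) (gumbelWatermark_nonneg _ _ _)))
        (div_nonneg (sub_nonneg.2 (hle x)) k.cast_nonneg)
    · rw [Finset.sum_add_distrib, ← Finset.mul_sum, ← Finset.mul_sum]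
      simp only [Finset.sum_const, Finset.card_univ, Fintype.card_fin, nsmul_eq_mul]
      rw [mul_div_cancel₀ _ hk']
      ring
    · rw [Finset.sum_add_distrib, ← Finset.mul_sum, ← Finset.mul_sum, huniq s, ← Finset.sum_div,
        Finset.sum_sub_distrib, ← Finset.mul_sum, hqsum, hp.2]
      ring
  have hopt := h.2 _ hπ'
  have e1 := h.1.sum_mul_tokenDeficit hp.1 c
  have e2 := hπ'.sum_mul_tokenDeficit hp.1 c
  have e3 : ∀ x s, (t * (1 / (k : ℝ) * W x s) + (p x - t * q x) / k)
      * tokenDeficit p (fun y => c y s) x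
      = (p x - t * q x) * (1 / (k : ℝ) * tokenDeficit p (fun y => c y s) x) := by
    intro x s
    linear_combination (t * (1 / (k : ℝ))) * gumbelWatermark_mul_tokenDeficit p (fun y => c y s) x
  simp_rw [e3, ← Finset.mul_sum] at e2
  rw [← Finset.mul_sum] at e1
  change _ ≤ ∑ x, (p x - t * q x) * _
  linarith

/-- If the empirical frequencies of the Gumbel tokens converge to `p` and the average deficits
converge, then the expected deficit of optimal couplings tends to zero. -/
theorem tendsto_sum_mul_tokenDeficit {X : Type*} [Fintype X] {p : X → ℝ}
    (hp : p ∈ stdSimplex ℝ X) {c : X → ℕ → ℝ} {D : X → ℝ}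
    (huniq : ∀ s, ∑ x, gumbelWatermark p (fun y => c y s) x = 1)
    (hfreq : ∀ x, Tendsto (fun k : ℕ =>
      1 / (k : ℝ) * ∑ s : Fin k, gumbelWatermark p (fun y => c y s) x) atTop (𝓝 (p x)))
    (hdef : ∀ x, Tendsto (fun k : ℕ =>
      1 / (k : ℝ) * ∑ s : Fin k, tokenDeficit p (fun y => c y s) x) atTop (𝓝 (D x)))
    {π : (k : ℕ) → X → Fin k → ℝ}
    (hπ : ∀ k, 0 < k → IsOTSolution p k (fun x s => c x s) (π k)) :
    Tendsto (fun k : ℕ => ∑ x, ∑ s : Fin k, π k x s * tokenDeficit p (fun y => c y s) x)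
      atTop (𝓝 0) := by
  set q : ℕ → X → ℝ := fun k x =>
    1 / (k : ℝ) * ∑ s : Fin k, gumbelWatermark p (fun y => c y s) x with hq
  -- with this choice, `t k → 1` and `t k * q k x ≤ p x`
  set t : ℕ → ℝ := fun k => 1 / (1 + ∑ x, |q k x - p x| / p x) with ht
  have hδ : ∀ k, 0 ≤ ∑ x, |q k x - p x| / p x := fun k =>
    Finset.sum_nonneg fun x _ => div_nonneg (abs_nonneg _) (hp.1 x)
  have htlim : Tendsto t atTop (𝓝 1) := by
    have h1 : Tendsto (fun k => ∑ x, |q k x - p x| / p x) atTop (𝓝 (∑ x, |p x - p x| / p x)) :=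
      tendsto_finsetSum _ fun x _ => (((hfreq x).sub_const _).abs).div_const _
    simp only [sub_self, abs_zero, zero_div, Finset.sum_const_zero] at h1
    have h2 : Tendsto t atTop (𝓝 (1 / (1 + 0))) :=
      tendsto_const_nhds.div (h1.const_add 1) (by norm_num)
    simpa using h2
  have htq : ∀ k x, t k * q k x ≤ p x := by
    intro k x
    simp only [ht]
    rw [one_div, inv_mul_le_iff₀ (by linarith [hδ k])]
    rcases (hp.1 x).eq_or_lt with h0 | hx
    · have : q k x = 0 := by
        simp [hq, gumbelWatermark, IsGumbelToken, ← h0]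
      rw [this, ← h0, mul_zero]
    · have h1 : |q k x - p x| / p x ≤ ∑ x, |q k x - p x| / p x :=
        Finset.single_le_sum (f := fun x => |q k x - p x| / p x)
          (fun x _ => div_nonneg (abs_nonneg _) (hp.1 x)) (Finset.mem_univ x)
      rw [div_le_iff₀ hx] at h1
      linarith [le_abs_self (q k x - p x)]
  have hub : Tendsto (fun k : ℕ => ∑ x, (p x - t k * q k x)
      * (1 / (k : ℝ) * ∑ s : Fin k, tokenDeficit p (fun y => c y s) x)) atTop
      (𝓝 (∑ x, (p x - 1 * p x) * D x)) :=
    tendsto_finsetSum _ fun x _ => ((htlim.mul (hfreq x)).const_sub _).mul (hdef x)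
  simp only [one_mul, sub_self, zero_mul, Finset.sum_const_zero] at hub
  refine tendsto_of_tendsto_of_tendsto_of_le_of_le' tendsto_const_nhds hub ?_ ?_
  · filter_upwards [eventually_gt_atTop 0] with k hk
    exact Finset.sum_nonneg fun x _ => Finset.sum_nonneg fun s _ =>
      mul_nonneg ((hπ k hk).1.nonneg x s) (tokenDeficit_nonneg _ _ _)
  · filter_upwards [eventually_gt_atTop 0] with k hk
    exact (hπ k hk).sum_mul_tokenDeficit_le hp hk (fun s => huniq s)
      (one_div_nonneg.2 (by linarith [hδ k])) (htq k)

/-- The indicator that `x` has positive probability and is not selected. -/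
noncomputable def unselected {X : Type*} (p : X → ℝ) (x : X) (g : X → ℝ) : ℝ :=
  if 0 < p x then 1 - gumbelWatermark p g x else 0

theorem unselected_nonneg {X : Type*} (p : X → ℝ) (x : X) (g : X → ℝ) : 0 ≤ unselected p x g := by
  unfold unselected
  split_ifs
  · linarith [gumbelWatermark_le_one p g x]
  · exact le_rfl

theorem unselected_eq_zero {X : Type*} [Finite X] {p g : X → ℝ} {x : X}
    (h : tokenDeficit p g x = 0) : unselected p x g = 0 := by
  unfold unselected
  split_ifs with hx
  · rw [gumbelWatermark, if_pos ((tokenDeficit_eq_zero_iff hx).1 h), sub_self]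
  · rfl

theorem integrable_unselected {X : Type*} [Fintype X] (p : X → ℝ) (x : X) :
    Integrable (unselected p x) (Measure.pi fun _ : X => gumbelMeasure) := by
  unfold unselected
  split_ifs
  · exact (integrable_const 1).sub (integrable_gumbelWatermark p x)
  · exact integrable_zero _ _ _

/-- Both couplings have the same side information marginal, so the `ℓ¹` distance is twice the mass
that `π` puts on tokens that are not selected. -/
theorem IsUniformCoupling.sum_abs_sub_gumbelWatermark {X : Type*} [Fintype X] {p : X → ℝ}
    (hp : ∀ x, 0 ≤ p x) {k : ℕ} {c π : X → Fin k → ℝ} (h : IsUniformCoupling p k π)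
    (huniq : ∀ s, ∑ x, gumbelWatermark p (fun y => c y s) x = 1) :
    ∑ x, ∑ s, |π x s - 1 / (k : ℝ) * gumbelWatermark p (fun y => c y s) x|
      = 2 * ∑ x, ∑ s, π x s * unselected p x (fun y => c y s) := by
  have h1 : ∀ x s, |π x s - 1 / (k : ℝ) * gumbelWatermark p (fun y => c y s) x|
      = 1 / (k : ℝ) * gumbelWatermark p (fun y => c y s) x - π x s
        + 2 * (π x s * unselected p x (fun y => c y s)) := by
    intro x s
    have hle := h.le_one_div x s
    have hnn := h.nonneg x s
    have hun : π x s * unselected p x (fun y => c y s)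
        = π x s * (1 - gumbelWatermark p (fun y => c y s) x) := by
      rcases (hp x).eq_or_lt with h0 | hx
      · simp [h.eq_zero h0.symm s]
      · rw [unselected, if_pos hx]
    rw [hun, gumbelWatermark]
    split_ifs
    · rw [abs_of_nonpos (by linarith)]; ring
    · rw [abs_of_nonneg (by linarith)]; ring
  simp_rw [h1, Finset.sum_add_distrib, ← Finset.mul_sum]
  rw [add_eq_right, Finset.sum_comm]
  refine Finset.sum_eq_zero fun s _ => ?_
  rw [Finset.sum_sub_distrib, ← Finset.mul_sum, huniq, h.sum_left, mul_one, sub_self]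

/-! ### Convergence to the Gumbel watermark -/

theorem theorem3 {X : Type*} [Fintype X] (p : X → ℝ) (hp : p ∈ stdSimplex ℝ X)
    {Ω : Type*} [MeasurableSpace Ω] (P : Measure Ω) [IsProbabilityMeasure P]
    (f : X → ℕ → Ω → ℝ)
    (hindep : iIndepFun (fun i : X × ℕ => f i.1 i.2) P)
    (hlaw : ∀ x s, HasLaw (f x s) gumbelMeasure P) :
    -- the optimal transport problem has a solution for every score matrix
    (∀ k : ℕ, 0 < k → ∀ c : X → Fin k → ℝ, ∃ π, IsOTSolution p k c π) ∧
    -- the Gumbel watermark almost surely selects exactly one token, and this token has law `p`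
    (∀ᵐ g ∂(Measure.pi fun _ : X => gumbelMeasure), ∃! x, IsGumbelToken p g x) ∧
    (∀ x, (Measure.pi fun _ : X => gumbelMeasure) {g | IsGumbelToken p g x}
      = ENNReal.ofReal (p x)) ∧
    -- almost surely, the distance in `ℓ¹` between any optimal coupling and the coupling that
    -- the Gumbel watermark induces with the same scores tends to zero
    (∀ᵐ ω ∂P, ∀ π : (k : ℕ) → X → Fin k → ℝ,
      (∀ k, 0 < k → IsOTSolution p k (fun x s => f x s ω) (π k)) →
      Tendsto (fun k : ℕ => ∑ x, ∑ s : Fin k,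
          |π k x s - 1 / (k : ℝ) * gumbelWatermark p (fun y => f y s ω) x|)
        atTop (𝓝 0)) ∧
    -- the joint law of the token and the scores of the side information under an optimal
    -- coupling converges to the joint law under the Gumbel watermark
    (∀ φ : X → (X → ℝ) → ℝ,
      (∀ x, Integrable (φ x) (Measure.pi fun _ : X => gumbelMeasure)) →
      ∀ᵐ ω ∂P, ∀ π : (k : ℕ) → X → Fin k → ℝ,
        (∀ k, 0 < k → IsOTSolution p k (fun x s => f x s ω) (π k)) →
        Tendsto (fun k : ℕ => ∑ x, ∑ s : Fin k, π k x s * φ x (fun y => f y s ω))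
          atTop
          (𝓝 (∫ g, ∑ x, gumbelWatermark p g x * φ x g
            ∂(Measure.pi fun _ : X => gumbelMeasure)))) := by
  have hg := hasLaw_score_vector hindep hlaw
  have hind := pairwise_indepFun_score_vector hindep fun x s => (hlaw x s).aemeasurable
  have huniq : ∀ᵐ ω ∂P, ∀ s, ∑ x, gumbelWatermark p (fun y => f y s ω) x = 1 := by
    rw [ae_all_iff]
    intro s
    have h := ae_sum_gumbelWatermark_eq_one hp
    rw [← (hg s).map_eq] at h
    exact ae_of_ae_map (hg s).aemeasurable h
  -- the total variation statement is also the input for the test functions below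
  have htv : ∀ᵐ ω ∂P, ∀ π : (k : ℕ) → X → Fin k → ℝ,
      (∀ k, 0 < k → IsOTSolution p k (fun x s => f x s ω) (π k)) →
      Tendsto (fun k : ℕ => ∑ x, ∑ s : Fin k,
        |π k x s - 1 / (k : ℝ) * gumbelWatermark p (fun y => f y s ω) x|) atTop (𝓝 0) := by
    have hfreq := ae_all_iff.2 fun x =>
      ae_tendsto_average hg hind (integrable_gumbelWatermark p x)
    have hdef := ae_all_iff.2 fun x =>
      ae_tendsto_average hg hind (integrable_tokenDeficit hp x)
    have hdom := ae_tendsto_weighted_sum_zero hg hind (u := unselected p)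
      (v := fun x g => tokenDeficit p g x) (integrable_unselected p)
      (fun x => (measurable_tokenDeficit p x).aestronglyMeasurable) (unselected_nonneg p)
      (fun x g => tokenDeficit_nonneg p g x) fun x g => unselected_eq_zero
    filter_upwards [huniq, hfreq, hdef, hdom] with ω h1 h2 h3 h4 π hπ
    simp_rw [integral_gumbelWatermark hp] at h2
    have h5 := h4 π (by
      filter_upwards [eventually_gt_atTop 0] with k hk x s
      exact ⟨(hπ k hk).1.nonneg x s, (hπ k hk).1.le_one_div x s⟩)
      (tendsto_sum_mul_tokenDeficit (c := fun x s => f x s ω) hp h1 h2 h3 hπ)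
    have h6 := h5.const_mul 2
    rw [mul_zero] at h6
    refine h6.congr' ?_
    filter_upwards [eventually_gt_atTop 0] with k hk
    exact ((hπ k hk).1.sum_abs_sub_gumbelWatermark hp.1 fun s => h1 s).symm
  refine ⟨fun k hk c => exists_isOTSolution hp hk c, ?_, measure_isGumbelToken hp, htv, ?_⟩
  · filter_upwards [ae_sum_gumbelWatermark_eq_one hp] with g h
    exact existsUnique_isGumbelToken_of_sum_eq_one h
  intro φ hφ
  have hWφ : Integrable (fun g => ∑ x, gumbelWatermark p g x * φ x g)
      (Measure.pi fun _ : X => gumbelMeasure) :=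
    integrable_finsetSum _ fun x _ => (hφ x).bdd_mul (c := 1)
      (measurable_gumbelWatermark p x).aestronglyMeasurable (ae_of_all _ fun g => by
        rw [Real.norm_of_nonneg (gumbelWatermark_nonneg p g x)]
        exact gumbelWatermark_le_one p g x)
  have hdom := ae_tendsto_weighted_sum_zero hg hind (u := fun x g => |φ x g|)
    (v := fun _ _ => 1) (fun x => (hφ x).abs) (fun x => aestronglyMeasurable_const)
    (fun x g => abs_nonneg _) (fun _ _ => zero_le_one) fun _ _ h => absurd h one_ne_zero
  filter_upwards [htv, hdom, ae_tendsto_average hg hind hWφ] with ω h1 h2 h3 π hπ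
  have h4 := h2 (fun k x s => |π k x s - 1 / (k : ℝ) * gumbelWatermark p (fun y => f y s ω) x|)
    (by
      filter_upwards [eventually_gt_atTop 0] with k hk x s
      have a1 := (hπ k hk).1.nonneg x s
      have a2 := (hπ k hk).1.le_one_div x s
      refine ⟨abs_nonneg _, ?_⟩
      unfold gumbelWatermark
      rw [abs_le]
      split_ifs <;> constructor <;> linarith)
    (by simpa using h1 π hπ)
  have h5 : Tendsto (fun k : ℕ => ∑ x, ∑ s : Fin k,
      (π k x s - 1 / (k : ℝ) * gumbelWatermark p (fun y => f y s ω) x)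
        * φ x (fun y => f y s ω)) atTop (𝓝 0) := by
    refine squeeze_zero_norm (fun k => ?_) h4
    refine (norm_sum_le _ _).trans (Finset.sum_le_sum fun x _ =>
      (norm_sum_le _ _).trans (Finset.sum_le_sum fun s _ => ?_))
    rw [Real.norm_eq_abs, abs_mul]
  have h6 := h5.add h3
  rw [zero_add] at h6
  refine h6.congr fun k => ?_
  rw [Finset.mul_sum, Finset.sum_comm, ← Finset.sum_add_distrib,
    Finset.sum_comm (f := fun x s => π k x s * _)]
  refine Finset.sum_congr rfl fun s _ => ?_
  rw [Finset.mul_sum, ← Finset.sum_add_distrib]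
  exact Finset.sum_congr rfl fun x _ => by ring
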